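/- A labeled hypergraph on $[n]=\{1,\dots,n\}$ with edge numbers $\ell=(\ell_2,\ell_3,\dots)$ (finitely many nonzero) consists, for each $i\ge 2$, of $\ell_i$ edges labeled by $[\ell_i]$, each an $i$-element subset of $[n]$; repeated edges are allowed. It is connected if $n\ge 1$ and any two vertices are joined by a path. Let $u_2,u_3,\dots$ be indeterminates, $u^\ell/\ell!=\prod_i u_i^{\ell_i}/\ell_i!$, and call $\sum_{i\ge2}(i-1)\ell_i$ the magnitude of $u^\ell$. Let $$C=\sum_{n\ge1}\frac{t^n}{n!}C_n(u_2,u_3,\dots)$$ be the exponential generating function of connected labeled hypergraphs, i.e. the coefficient of $u^\ell/\ell!$ in $C_n$ is the number of connected labeled hypergraphs on $[n]$ with edge numbers $\ell$. Let $T_n$ be the sum of all terms of magnitude $n-1$ in $C_n$, and put $$T=\sum_{n\ge1}\frac{t^n}{n!}T_n,\qquad R=t\,\frac{\partial T}{\partial t}.$$ Then, for every $n\ge1$, $$\left[\frac{t^n}{n!}\right]R=\sum_{\lambda\vdash n-1}\binom{n-1}{\lambda_1,\lambda_2,\dots}\prod_{i\ge1}\frac{(n\,u_{i+1})^{a_i}}{a_i!},$$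 where $\lambda$ runs over the partitions of $n-1$, $\lambda_1,\lambda_2,\dots$ are its parts, and $a_i$ is the number of parts of size $i$. Moreover $\left[\frac{t^n}{n!}\right]T=\frac1n\left[\frac{t^n}{n!}\right]R$ for every $n\ge1$, and $$\begin{aligned} \left[\tfrac{t}{1!}\right]T&=1,\\ \left[\tfrac{t^2}{2!}\right]T&=u_2,\\ \left[\tfrac{t^3}{3!}\right]T&=u_3+3u_2^2,\\ \left[\tfrac{t^4}{4!}\right]T&=u_4+12u_2u_3+16u_2^3,\\ \left[\tfrac{t^5}{5!}\right]T&=u_5+20u_2u_4+15u_3^2+150u_3u_2^2+125u_2^4,\\ \left[\tfrac{t^6}{6!}\right]T&=u_6+30u_2u_5+60u_4u_3+360u_4u_2^2+540u_2u_3^2+2160u_3u_2^3+1296u_2^5. \end{aligned}$$ -/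

import Mathlib

open scoped Nat

noncomputable section

namespace Hyper

/-- A labeled hypergraph with vertex set `Fin n` having `ℓ i` edges of size `i` for each `i`,
the edges of size `i` being labeled by `Fin (ℓ i)`. Repeated edges are allowed; every edge has
at least two vertices. -/
structure LabeledHypergraph (n : ℕ) (ℓ : ℕ →₀ ℕ) where
  /-- The vertex set of the `i`-edge with label `j`. -/
  edge : (i : ℕ) → Fin (ℓ i) → Finset (Fin n)
  card_edge : ∀ i j, (edge i j).card = i
  two_le_card_edge : ∀ i j, 2 ≤ (edge i j).card

/-- There are only finitely many such hypergraphs, so that counting them is meaningful. -/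
theorem LabeledHypergraph.finite (n : ℕ) (ℓ : ℕ →₀ ℕ) : Finite (LabeledHypergraph n ℓ) := by
  have hE : Finite ((i : ℕ) × Fin (ℓ i)) := by
    refine Finite.of_injective
      (β := (i : ℓ.support) × Fin (ℓ i))
      (fun p => ⟨⟨p.1, Finsupp.mem_support_iff.2 fun h => (Fin.cast h p.2).elim0⟩, p.2⟩) ?_
    rintro ⟨i, j⟩ ⟨i', j'⟩ h
    simp only [Sigma.mk.injEq, Subtype.mk.injEq] at h
    obtain ⟨rfl, h⟩ := h
    simpa using h
  refine Finite.of_injective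
    (β := ((i : ℕ) × Fin (ℓ i)) → Finset (Fin n)) (fun H p => H.edge p.1 p.2) ?_
  rintro ⟨e, _, _⟩ ⟨e', _, _⟩ h
  have : e = e' := by
    funext i j
    exact congrFun h ⟨i, j⟩
  subst this
  rfl

/-- Two vertices are adjacent if some edge contains both. -/
def LabeledHypergraph.Adj {n : ℕ} {ℓ : ℕ →₀ ℕ} (H : LabeledHypergraph n ℓ) (v w : Fin n) : Prop :=
  ∃ i j, v ∈ H.edge i j ∧ w ∈ H.edge i j

/-- A hypergraph is connected if it has a vertex and any two vertices are joined by a walk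
(equivalently, by a path, as a shortest walk repeats no vertex and no edge). -/
def LabeledHypergraph.Connected {n : ℕ} {ℓ : ℕ →₀ ℕ} (H : LabeledHypergraph n ℓ) : Prop :=
  0 < n ∧ ∀ v w : Fin n, Relation.ReflTransGen H.Adj v w

/-- The number of connected labeled hypergraphs on `n` vertices with `ℓ i` edges of size `i`
for each `i`. It vanishes if `ℓ 0 ≠ 0` or `ℓ 1 ≠ 0`. -/
def numConnected (n : ℕ) (ℓ : ℕ →₀ ℕ) : ℕ :=
  Nat.card {H : LabeledHypergraph n ℓ // H.Connected}

/-- Formal power series over `ℚ` in the indeterminates `u_i`. -/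
abbrev Coeffs : Type := MvPowerSeries ℕ ℚ

/-- The indeterminate `u_i`, marking edges of size `i`. -/
def u (i : ℕ) : Coeffs := MvPowerSeries.X i

/-- `[t^n / n!] F`, for a power series `F` in `t`. -/
def egfCoeff (n : ℕ) (F : PowerSeries Coeffs) : Coeffs :=
  (n ! : ℚ) • PowerSeries.coeff n F

/-- The exponential generating function
`C = ∑ n ℓ, numConnected n ℓ * (t ^ n / n!) * (u ^ ℓ / ℓ!)` of connected labeled hypergraphs. -/
def C : PowerSeries Coeffs :=
  PowerSeries.mk fun n => (1 / (n ! : ℚ)) •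
    ((fun ℓ : ℕ →₀ ℕ => (numConnected n ℓ : ℚ) / ℓ.prod fun _ k => (k ! : ℚ)) : Coeffs)

/-- The magnitude `∑ i, (i - 1) * ℓ i` of the monomial `u ^ ℓ`. -/
def magnitude (ℓ : ℕ →₀ ℕ) : ℕ := ℓ.sum fun i k => (i - 1) * k

/-- The sum of all terms of magnitude `n - 1` in `[t^n / n!] C`. -/
def leadingPart (n : ℕ) : Coeffs :=
  fun ℓ : ℕ →₀ ℕ =>
    if magnitude ℓ + 1 = n then MvPowerSeries.coeff ℓ (egfCoeff n C) else 0

/-- The generating function `T` of the leading terms of `C`. -/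
def T : PowerSeries Coeffs :=
  PowerSeries.mk fun n => (1 / (n ! : ℚ)) • leadingPart n

/-- `R = t * ∂T/∂t`. -/
def R : PowerSeries Coeffs :=
  PowerSeries.X * PowerSeries.derivative Coeffs T

/-- The multinomial coefficient `m! / (λ₁! λ₂! ⋯)`, where `λ₁, λ₂, …` are the parts of the
partition `p` of `m`. -/
def multinomialOfParts {m : ℕ} (p : Nat.Partition m) : ℚ :=
  (m ! : ℚ) / (p.parts.map fun k => (k ! : ℚ)).prod

end Hyper

end

/-! Magnitude `n - 1` is the least that a connected hypergraph on `n` vertices can have, so `T`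
counts hypertrees. They are counted by revealing the edges one at a time and contracting each into a
point, which leads to a more general count: edges on `V` that connect the fibres of a map `π : V →
Q`.

If `Q` has exactly `1 + ∑ (sᵢ - 1)` points, every edge must meet as many classes as it has vertices.
Induction on the number `k` of edges then gives `∏ |fibre| * |V|^(k-1) * (|Q|-1)! / ∏ (sᵢ-1)!`
families (`numConnects_mul`). The induction closes because the product of fibre sizes, summed over
the possible first edges, reproduces itself up to the factor `|V| * choose (|Q|-1) (s₀-1)`
(`sum_weight_contract`).

For `π = id` all fibres have size 1 (`numConnected_mul`). The operator `t ∂/∂t` supplies the missing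
factor `n`, and edge numbers of magnitude `n - 1` correspond to partitions of `n - 1`, an `i`-edge
being a part `i - 1`. -/

namespace Hyper

open Finset

/-! ### Contraction of edges and connectivity. -/

/-- The map collapsing a finset `S` to the point `none`. -/
def contract {Q : Type} [DecidableEq Q] (S : Finset Q) (q : Q) : Option {q // q ∉ S} :=
  if h : q ∈ S then none else some ⟨q, h⟩

theorem contract_eq_iff {Q : Type} [DecidableEq Q] (S : Finset Q) (q r : Q) :
    contract S q = contract S r ↔ q = r ∨ (q ∈ S ∧ r ∈ S) := by
  unfold contract
  by_cases hq : q ∈ S <;> by_cases hr : r ∈ S <;> simp [hq, hr]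
  · rintro rfl; exact hr hq
  · rintro rfl; exact hq hr

theorem contract_eq_none_iff {Q : Type} [DecidableEq Q] (S : Finset Q) (q : Q) :
    contract S q = none ↔ q ∈ S := by
  unfold contract
  split_ifs with h <;> simp [h]

theorem contract_eq_some_iff {Q : Type} [DecidableEq Q] (S : Finset Q) (q : Q)
    (r : {q // q ∉ S}) : contract S q = some r ↔ q = r := by
  unfold contract
  split_ifs with h
  · exact iff_of_false (by simp) fun h' => r.2 (h' ▸ h)
  · simp [Subtype.ext_iff]

theorem contract_surjective {Q : Type} [DecidableEq Q] {S : Finset Q} (hS : S.Nonempty) :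
    Function.Surjective (contract S) := by
  rintro (_ | ⟨q, hq⟩)
  · obtain ⟨q, hq⟩ := hS
    exact ⟨q, by simp [contract, hq]⟩
  · exact ⟨q, by simp [contract, hq]⟩

theorem card_option_compl {Q : Type} [Fintype Q] [DecidableEq Q] (S : Finset Q) :
    Fintype.card (Option {q // q ∉ S}) + #S = Fintype.card Q + 1 := by
  have h := Fintype.card_subtype_compl (fun q => q ∈ S)
  have h2 := Finset.card_le_univ S
  simp only [Fintype.card_coe] at h
  rw [Fintype.card_option, h]
  omega

/-- Two vertices are linked if `π` identifies them or some edge contains both. -/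
def Linked {V Q ι : Type} (π : V → Q) (f : ι → Finset V) (v w : V) : Prop :=
  π v = π w ∨ ∃ i, v ∈ f i ∧ w ∈ f i

/-- The edges `f` connect the fibres of `π`. -/
def Connects {V Q ι : Type} (π : V → Q) (f : ι → Finset V) : Prop :=
  ∀ v w, Relation.ReflTransGen (Linked π f) v w

/-- A step through `e` becomes an identification once the image of `e` is a point. Conversely, two
vertices newly identified lie over images of some `x, y ∈ e`, and are joined through `x` and `y`. -/
theorem connects_cons_iff {V Q : Type} [DecidableEq Q] {k : ℕ} (π : V → Q)
    (e : Finset V) (f : Fin k → Finset V) :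
    Connects π (Fin.cons e f : Fin (k + 1) → Finset V) ↔
      Connects (contract (e.image π) ∘ π) f := by
  have key : ∀ v w, Relation.ReflTransGen (Linked π (Fin.cons e f : Fin (k + 1) → Finset V)) v w ↔
      Relation.ReflTransGen (Linked (contract (e.image π) ∘ π) f) v w := by
    intro v w
    constructor
    · refine Relation.ReflTransGen.mono ?_ v w
      rintro a b (h | ⟨i, h⟩)
      · exact Or.inl (by simp [h])
      · induction i using Fin.cases with
        | zero =>
          refine Or.inl ?_
          simp only [Function.comp, contract_eq_iff]
          exact Or.inr ⟨mem_image_of_mem _ h.1, mem_image_of_mem _ h.2⟩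
        | succ i => exact Or.inr ⟨i, h⟩
    · intro h
      induction h with
      | refl => exact .refl
      | tail _ h ih =>
        refine ih.trans ?_
        rcases h with h | ⟨i, h⟩
        · simp only [Function.comp, contract_eq_iff] at h
          rcases h with h | ⟨ha, hb⟩
          · exact .single (Or.inl h)
          · obtain ⟨x, hx, hxa⟩ := mem_image.1 ha
            obtain ⟨y, hy, hyb⟩ := mem_image.1 hb
            have hxy : Linked π (Fin.cons e f : Fin (k + 1) → Finset V) x y :=
              Or.inr ⟨0, hx, hy⟩
            exact .tail (.tail (.single (Or.inl hxa.symm)) hxy) (Or.inl hyb)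
        · exact .single (Or.inr ⟨i.succ, h⟩)
  simp only [Connects, key]

theorem connects_empty_iff {V Q ι : Type} [IsEmpty ι] {π : V → Q} (f : ι → Finset V) :
    Connects π f ↔ ∀ v w, π v = π w := by
  constructor
  · intro h v w
    induction h v w with
    | refl => rfl
    | tail _ h ih =>
      rcases h with h | ⟨i, _⟩
      · exact ih.trans h
      · exact isEmptyElim i
  · exact fun h v w => .single (Or.inl (h v w))

/-- Contracting an edge removes at most `#e - 1` points of `Q`, and at most one point may be left at
the end. -/
theorem Connects.card_le {V Q : Type} [Fintype Q] [DecidableEq Q] {k : ℕ} {π : V → Q}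
    (hπ : Function.Surjective π) {f : Fin k → Finset V} (hf : ∀ i, (f i).Nonempty)
    (h : Connects π f) : Fintype.card Q ≤ 1 + ∑ i, (#(f i) - 1) := by
  induction k generalizing Q with
  | zero =>
    rw [connects_empty_iff] at h
    have : Subsingleton Q := ⟨fun a b => by
      obtain ⟨v, rfl⟩ := hπ a
      obtain ⟨w, rfl⟩ := hπ b
      exact h v w⟩
    simpa using Fintype.card_le_one_iff_subsingleton.2 this
  | succ k ih =>
    rw [← Fin.cons_self_tail f, connects_cons_iff] at h
    have hS : ((f 0).image π).Nonempty := (hf 0).image π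
    have h1 := ih ((contract_surjective hS).comp hπ) (f := Fin.tail f) (fun i => hf i.succ) h
    have h2 := card_option_compl ((f 0).image π)
    have h3 : #((f 0).image π) ≤ #(f 0) := card_image_le
    have h4 := (hf 0).card_pos
    rw [Fin.sum_univ_succ]
    simp only [Fin.tail] at h1
    omega

/-! ### Counting minimal connecting families of edges. -/

section Counting

variable {V Q : Type} [Fintype V] [DecidableEq Q]

/-- The number of vertices over `q`. -/
def fibreCard (π : V → Q) (q : Q) : ℕ := #{v | π v = q}

theorem sum_fibreCard [Fintype Q] (π : V → Q) : ∑ q, fibreCard π q = Fintype.card V := by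
  simp only [fibreCard]
  rw [← card_univ, ← card_eq_sum_card_fiberwise (f := π) (t := univ) (by simp)]

/-- The cardinality condition makes `π` injective on `e`, so `e` amounts to a choice of one vertex
over each point of `S`. -/
theorem card_transversals [DecidableEq V] (π : V → Q) (S : Finset Q) :
    #{e : Finset V | e.image π = S ∧ #e = #S} = ∏ q ∈ S, fibreCard π q := by
  classical
  simp only [fibreCard]
  rw [← card_pi]
  symm
  refine card_bij (fun g _ => S.attach.image fun q => g q.1 q.2) ?_ ?_ ?_
  · intro g hg
    simp only [mem_pi, mem_filter, mem_univ, true_and] at hg ⊢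
    have himg : (S.attach.image fun q => g q.1 q.2).image π = S := by
      ext q
      simp only [mem_image, mem_attach, true_and, Subtype.exists]
      constructor
      · rintro ⟨_, ⟨a, ha, rfl⟩, rfl⟩
        rwa [hg a ha]
      · exact fun hq => ⟨_, ⟨q, hq, rfl⟩, hg q hq⟩
    refine ⟨himg, le_antisymm (card_image_le.trans (by simp)) ?_⟩
    conv_lhs => rw [← himg]
    exact card_image_le
  · intro g hg g' hg' h
    simp only [mem_pi, mem_filter, mem_univ, true_and] at hg hg'
    funext q hq
    have : g q hq ∈ S.attach.image fun q => g' q.1 q.2 := by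
      rw [← h]
      exact mem_image.2 ⟨⟨q, hq⟩, mem_attach _ _, rfl⟩
    simp only [mem_image, mem_attach, true_and, Subtype.exists] at this
    obtain ⟨r, hr, h⟩ := this
    have : r = q := by rw [← hg q hq, ← hg' r hr, h]
    subst this
    exact h.symm
  · intro e he
    simp only [mem_filter, mem_univ, true_and] at he
    obtain ⟨rfl, hc⟩ := he
    have hinj : Set.InjOn π e := card_image_iff.1 hc.symm
    have hex : ∀ q ∈ e.image π, ∃ v ∈ e, π v = q := fun q hq => mem_image.1 hq
    choose g hg hgπ using hex
    refine ⟨g, by simpa using hgπ, ?_⟩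
    refine eq_of_subset_of_card_le ?_ ?_
    · intro v hv
      obtain ⟨q, -, rfl⟩ := mem_image.1 hv
      exact hg _ _
    · rw [card_image_of_injective _ ?_, card_attach, hc]
      intro q r h
      apply Subtype.ext
      rw [← hgπ q.1 q.2, ← hgπ r.1 r.2]
      exact congrArg π h

theorem sum_transversals [Fintype Q] [DecidableEq V] (π : V → Q) (s : ℕ) (G : Finset Q → ℕ) :
    ∑ e ∈ powersetCard s (univ : Finset V) with #(e.image π) = s, G (e.image π) =
      ∑ S ∈ powersetCard s (univ : Finset Q), (∏ q ∈ S, fibreCard π q) * G S := by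
  rw [← sum_fiberwise_of_maps_to (t := powersetCard s (univ : Finset Q))
    (g := fun e : Finset V => e.image π)
    (fun e he => mem_powersetCard.2 ⟨subset_univ _, (mem_filter.1 he).2⟩)]
  refine sum_congr rfl fun S hS => ?_
  have hS' := (mem_powersetCard.1 hS).2
  rw [sum_congr rfl (g := fun _ => G S) (fun e he => by rw [(mem_filter.1 he).2]), sum_const,
    smul_eq_mul, ← card_transversals]
  congr 2
  ext e
  simp only [mem_filter, mem_powersetCard, mem_univ, true_and, subset_univ]
  constructor
  · rintro ⟨⟨h1, h2⟩, h3⟩; exact ⟨h3, by omega⟩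
  · rintro ⟨h1, h2⟩; exact ⟨⟨by omega, by rw [h1, hS']⟩, h1⟩

theorem card_powersetCard_succ_mem [Fintype Q] (s : ℕ) (q : Q) :
    #{S ∈ powersetCard (s + 1) (univ : Finset Q) | q ∈ S} = (Fintype.card Q - 1).choose s := by
  rw [← card_univ, ← card_erase_of_mem (mem_univ q), ← card_powersetCard]
  refine card_nbij' (fun S => S.erase q) (fun S => insert q S) ?_ ?_ ?_ ?_
  · intro S hS
    simp only [coe_filter, mem_powersetCard, Set.mem_ofPred_eq] at hS
    simp only [mem_coe, mem_powersetCard]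
    refine ⟨erase_subset_erase _ hS.1.1, by rw [card_erase_of_mem hS.2, hS.1.2]; rfl⟩
  · intro S hS
    simp only [mem_coe, mem_powersetCard] at hS
    have : q ∉ S := fun h => by simpa using hS.1 h
    simp [mem_powersetCard, card_insert_of_notMem this, hS.2]
  · intro S hS
    simp only [coe_filter, Set.mem_ofPred_eq] at hS
    exact insert_erase hS.2
  · intro S hS
    simp only [mem_coe, mem_powersetCard] at hS
    exact erase_insert fun h => by simpa using hS.1 h

theorem sum_powersetCard_sum [Fintype Q] (s : ℕ) (a : Q → ℕ) :
    ∑ S ∈ powersetCard (s + 1) (univ : Finset Q), ∑ q ∈ S, a q =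
      (∑ q, a q) * (Fintype.card Q - 1).choose s := by
  have : ∀ S : Finset Q, ∑ q ∈ S, a q = ∑ q, if q ∈ S then a q else 0 := fun S => by
    simp
  rw [sum_congr rfl fun S _ => this S, sum_comm, sum_mul]
  refine sum_congr rfl fun q _ => ?_
  rw [← card_powersetCard_succ_mem s q, ← sum_filter, sum_const, smul_eq_mul, mul_comm]

/-- The fibres over `S` merge into the fibre over `none`; the others are unchanged. -/
theorem prod_fibreCard_contract [Fintype Q] (π : V → Q) (S : Finset Q) :
    ∏ q, fibreCard (contract S ∘ π) q =
      (∑ q ∈ S, fibreCard π q) * ∏ q ∈ Sᶜ, fibreCard π q := by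
  rw [Fintype.prod_option]
  congr 1
  · simp only [fibreCard]
    rw [card_eq_sum_card_fiberwise (f := π) (t := S)]
    · refine sum_congr rfl fun q hq => congrArg card (ext fun v => ?_)
      rw [mem_filter, mem_filter, mem_filter, Function.comp_apply, contract_eq_none_iff]
      constructor
      · exact fun h => ⟨mem_univ _, h.2⟩
      · rintro ⟨_, rfl⟩
        exact ⟨⟨mem_univ _, hq⟩, rfl⟩
    · intro v hv
      exact (contract_eq_none_iff S _).1 (mem_filter.1 (mem_coe.1 hv)).2
  · rw [prod_subtype (Sᶜ) (p := fun q => q ∉ S) (by simp) (fun q => fibreCard π q)]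
    refine prod_congr rfl fun q _ => congrArg card (ext fun v => ?_)
    rw [mem_filter, mem_filter, Function.comp_apply, contract_eq_some_iff]

/-- Over each `S` there are `∏_{q ∈ S} |fibre|` transversal edges. This product completes `∏_{q ∉
S}` to the full product, leaving the factor `∑_{q ∈ S} |fibre|`; summed over all `S`, it counts each
point `choose (|Q|-1) s` times. -/
theorem sum_weight_contract [Fintype Q] [DecidableEq V] (π : V → Q) (s : ℕ) :
    ∑ e ∈ powersetCard (s + 1) (univ : Finset V) with #(e.image π) = s + 1,
        ∏ q, fibreCard (contract (e.image π) ∘ π) q =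
      (∏ q, fibreCard π q) * Fintype.card V * (Fintype.card Q - 1).choose s := by
  rw [sum_transversals π (s + 1) fun S => ∏ q, fibreCard (contract S ∘ π) q,
    mul_assoc, ← sum_fibreCard π, ← sum_powersetCard_sum, mul_sum]
  refine sum_congr rfl fun S _ => ?_
  rw [prod_fibreCard_contract, ← prod_mul_prod_compl S]
  ring

open Classical in
/-- The number of edge families with sizes `s` that connect the fibres of `π`. -/
noncomputable def numConnects {k : ℕ} (π : V → Q) (s : Fin k → ℕ) : ℕ :=
  #{f : Fin k → Finset V | (∀ i, #(f i) = s i) ∧ Connects π f}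

theorem numConnects_succ [DecidableEq V] {k : ℕ} (π : V → Q) (s : Fin (k + 1) → ℕ) :
    numConnects π s = ∑ e ∈ powersetCard (s 0) (univ : Finset V),
      numConnects (contract (e.image π) ∘ π) (Fin.tail s) := by
  classical
  simp only [numConnects]
  rw [← card_sigma]
  refine card_bij' (fun f _ => ⟨f 0, Fin.tail f⟩) (fun p _ => Fin.cons p.1 p.2) ?_ ?_ ?_ ?_
  · intro f hf
    simp only [mem_filter, mem_univ, true_and, mem_sigma, mem_powersetCard, subset_univ] at hf ⊢
    refine ⟨hf.1 0, fun i => hf.1 i.succ, ?_⟩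
    rw [← connects_cons_iff, Fin.cons_self_tail]
    exact hf.2
  · rintro ⟨e, f⟩ hf
    simp only [mem_filter, mem_univ, true_and, mem_sigma, mem_powersetCard, subset_univ] at hf ⊢
    refine ⟨fun i => ?_, (connects_cons_iff _ _ _).2 hf.2.2⟩
    induction i using Fin.cases with
    | zero => exact hf.1
    | succ i => exact hf.2.1 i
  · intro f _
    simp
  · rintro ⟨e, f⟩ _
    simp

theorem numConnects_eq_zero [Fintype Q] {k : ℕ} {π : V → Q} (hπ : Function.Surjective π) {s : Fin k → ℕ}
    (hs : ∀ i, 1 ≤ s i) (h : 1 + ∑ i, (s i - 1) < Fintype.card Q) : numConnects π s = 0 := by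
  classical
  simp only [numConnects, card_eq_zero, filter_eq_empty_iff, mem_univ, true_implies, not_and]
  intro f hf hc
  have := hc.card_le hπ fun i => card_pos.1 (by rw [hf i]; exact hs i)
  simp only [hf] at this
  omega

/-- The factor `Fintype.card V` on the left avoids the exponent `k - 1`, which would be negative for
`k = 0`. -/
theorem numConnects_mul [Fintype Q] [DecidableEq V] {k : ℕ} {π : V → Q} (hπ : Function.Surjective π) {s : Fin k → ℕ}
    (hs : ∀ i, 1 ≤ s i) (h : Fintype.card Q = 1 + ∑ i, (s i - 1)) :
    numConnects π s * (∏ i, (s i - 1)!) * Fintype.card V =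
      (∏ q, fibreCard π q) * Fintype.card V ^ k * (Fintype.card Q - 1)! := by
  classical
  induction k generalizing Q with
  | zero =>
    simp only [univ_eq_empty, sum_empty, add_zero] at h
    have hu := Fintype.card_eq_one_iff_nonempty_unique.1 h
    obtain ⟨hu⟩ := hu
    have : numConnects π s = 1 := by
      simp only [numConnects]
      rw [filter_true_of_mem]
      · simp
      · intro f _
        exact ⟨fun i => i.elim0, (connects_empty_iff f).2 fun _ _ => Subsingleton.elim _ _⟩
    have h2 := sum_fibreCard π
    rw [Fintype.sum_unique] at h2
    simp [this, h2]
  | succ k ih =>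
    obtain ⟨m, hm⟩ : ∃ m, s 0 = m + 1 := ⟨s 0 - 1, by have := hs 0; omega⟩
    rw [Fin.sum_univ_succ, hm, Nat.add_sub_cancel] at h
    rw [numConnects_succ, hm, Fin.prod_univ_succ, hm, Nat.add_sub_cancel]
    have hcard : ∀ e ∈ powersetCard (m + 1) (univ : Finset V),
        Function.Surjective (contract (e.image π) ∘ π) := fun e he =>
      (contract_surjective ((card_pos.1 (by rw [(mem_powersetCard.1 he).2]; omega)).image π)).comp hπ
    -- A first edge meeting fewer than `m + 1` classes contributes nothing: its contraction leaves
    -- more points than the remaining edges can connect.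
    rw [← sum_filter_of_ne (p := fun e => #(e.image π) = m + 1)]
    · have step : ∀ e ∈ powersetCard (m + 1) (univ : Finset V), #(e.image π) = m + 1 →
          numConnects (contract (e.image π) ∘ π) (Fin.tail s) * (∏ i : Fin k, (s i.succ - 1)!) *
            Fintype.card V = (∏ q, fibreCard (contract (e.image π) ∘ π) q) *
              (Fintype.card V ^ k * (Fintype.card Q - 1 - m)!) := by
        intro e he hc
        have h1 := card_option_compl (e.image π)
        have h2 := ih (hcard e he) (s := Fin.tail s) (fun i => hs i.succ)
          (by simp only [Fin.tail]; omega)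
        rw [← mul_assoc]
        simp only [Fin.tail] at h2 ⊢
        rw [h2]
        congr 2
        omega
      have hch := Nat.choose_mul_factorial_mul_factorial (n := Fintype.card Q - 1) (k := m)
        (by omega)
      calc _ = (∑ e ∈ powersetCard (m + 1) (univ : Finset V) with #(e.image π) = m + 1,
            numConnects (contract (e.image π) ∘ π) (Fin.tail s) *
              (∏ i : Fin k, (s i.succ - 1)!) * Fintype.card V) * m ! := by
            rw [← sum_mul, ← sum_mul]; ring
        _ = (∑ e ∈ powersetCard (m + 1) (univ : Finset V) with #(e.image π) = m + 1,
            ∏ q, fibreCard (contract (e.image π) ∘ π) q) *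
              (Fintype.card V ^ k * (Fintype.card Q - 1 - m)!) * m ! := by
            rw [sum_congr rfl fun e he => step e (mem_filter.1 he).1 (mem_filter.1 he).2, ← sum_mul]
        _ = _ := by
            rw [sum_weight_contract, ← hch]; ring
    · intro e he hne
      by_contra hc
      apply hne
      have h1 := card_option_compl (e.image π)
      have h2 : #(e.image π) ≤ #e := card_image_le
      rw [(mem_powersetCard.1 he).2] at h2
      refine numConnects_eq_zero (hcard e he) (fun i => hs i.succ) ?_
      simp only [Fin.tail]
      omega

end Counting

/-! ### From labeled hypergraphs to families of edges. -/

theorem LabeledHypergraph.ext_edge {n : ℕ} {ℓ : ℕ →₀ ℕ} {H H' : LabeledHypergraph n ℓ}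
    (h : ∀ i j, H.edge i j = H'.edge i j) : H = H' := by
  obtain ⟨e, _, _⟩ := H
  obtain ⟨e', _, _⟩ := H'
  have : e = e' := by
    funext i j
    exact h i j
  subst this
  rfl

/-- The labeled edges of a hypergraph with edge numbers `ℓ`. -/
abbrev EdgeIndex (ℓ : ℕ →₀ ℕ) : Type := (i : ℓ.support) × Fin (ℓ i)

theorem mem_support_of_fin {ℓ : ℕ →₀ ℕ} {i : ℕ} (j : Fin (ℓ i)) : i ∈ ℓ.support :=
  Finsupp.mem_support_iff.2 fun h => (Fin.cast h j).elim0

theorem card_edgeIndex (ℓ : ℕ →₀ ℕ) : Fintype.card (EdgeIndex ℓ) = ℓ.sum fun _ k => k := by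
  rw [Fintype.card_sigma, Finsupp.sum, ← sum_coe_sort ℓ.support fun i => ℓ i]
  simp only [Fintype.card_fin]

/-- For `π = id`, the identification case of `Linked` is equality, which adds only trivial steps to
a walk. -/
theorem numConnected_eq_numConnects (n : ℕ) {ℓ : ℕ →₀ ℕ} (hn : 0 < n)
    (hℓ : ∀ i ∈ ℓ.support, 2 ≤ i) {k : ℕ} (ψ : Fin k ≃ EdgeIndex ℓ) :
    numConnected n ℓ = numConnects (id : Fin n → Fin n) fun j => ((ψ j).1 : ℕ) := by
  classical
  rw [numConnected, numConnects, ← Fintype.card_subtype, ← Nat.card_eq_fintype_card]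
  have hconn : ∀ (H : LabeledHypergraph n ℓ) (f : Fin k → Finset (Fin n)),
      (∀ x, f x = H.edge (ψ x).1 (ψ x).2) → (H.Connected ↔ Connects id f) := by
    intro H f hf
    have hadj : ∀ v w, H.Adj v w ↔ ∃ x, v ∈ f x ∧ w ∈ f x := by
      intro v w
      simp only [hf]
      constructor
      · rintro ⟨i, j, h⟩
        refine ⟨ψ.symm ⟨⟨i, mem_support_of_fin j⟩, j⟩, ?_⟩
        rw [Equiv.apply_symm_apply]
        exact h
      · rintro ⟨x, h⟩
        exact ⟨_, _, h⟩
    constructor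
    · intro h v w
      exact Relation.ReflTransGen.mono (fun a b hab => Or.inr ((hadj a b).1 hab)) _ _ (h.2 v w)
    · refine fun h => ⟨hn, fun v w => ?_⟩
      have h := h v w
      induction h with
      | refl => exact .refl
      | tail _ h ih =>
        rcases h with h | h
        · cases h
          exact ih
        · exact ih.tail ((hadj _ _).2 h)
  refine Nat.card_eq_of_bijective (fun H => ⟨fun x => H.1.edge (ψ x).1 (ψ x).2,
    fun x => H.1.card_edge _ _, (hconn H.1 _ fun _ => rfl).1 H.2⟩) ⟨?_, ?_⟩
  · intro H H' h
    have h := congrArg Subtype.val h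
    refine Subtype.ext (LabeledHypergraph.ext_edge fun i j => ?_)
    have h := congrFun h (ψ.symm ⟨⟨i, mem_support_of_fin j⟩, j⟩)
    dsimp only at h
    rw [Equiv.apply_symm_apply] at h
    exact h
  · rintro ⟨f, hf, hc⟩
    have hcard : ∀ i (j : Fin (ℓ i)), #(f (ψ.symm ⟨⟨i, mem_support_of_fin j⟩, j⟩)) = i := by
      intro i j
      rw [hf, Equiv.apply_symm_apply]
    let H : LabeledHypergraph n ℓ :=
      ⟨fun i j => f (ψ.symm ⟨⟨i, mem_support_of_fin j⟩, j⟩), hcard,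
        fun i j => (hcard i j).symm ▸ hℓ i (mem_support_of_fin j)⟩
    have hH : ∀ x, f x = H.edge (ψ x).1 (ψ x).2 := fun x =>
      congrArg f (ψ.symm_apply_apply x).symm
    exact ⟨⟨H, (hconn H f hH).2 hc⟩, Subtype.ext (funext fun x => (hH x).symm)⟩

theorem numConnected_eq_zero (n : ℕ) {ℓ : ℕ →₀ ℕ} {i : ℕ} (hi : i ∈ ℓ.support) (h : i < 2) :
    numConnected n ℓ = 0 := by
  rw [numConnected, Nat.card_eq_zero]
  refine Or.inl ⟨fun H => ?_⟩
  have h1 := H.1.two_le_card_edge i ⟨0, Nat.pos_of_ne_zero (Finsupp.mem_support_iff.1 hi)⟩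
  rw [H.1.card_edge] at h1
  omega

theorem numConnected_mul {n : ℕ} {ℓ : ℕ →₀ ℕ} (hℓ : ∀ i ∈ ℓ.support, 2 ≤ i)
    (h : magnitude ℓ + 1 = n) :
    numConnected n ℓ * (ℓ.prod fun i k => (i - 1)! ^ k) * n =
      n ^ (ℓ.sum fun _ k => k) * (n - 1)! := by
  let ψ := (Fintype.equivFin (EdgeIndex ℓ)).symm
  have hsum : ∑ j, (((ψ j).1 : ℕ) - 1) = magnitude ℓ := by
    rw [ψ.sum_comp fun x => ((x.1 : ℕ) - 1), Fintype.sum_sigma, magnitude, Finsupp.sum,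
      ← sum_coe_sort ℓ.support fun i => (i - 1) * ℓ i]
    simp [mul_comm]
  have hprod : ∏ j, (((ψ j).1 : ℕ) - 1)! = ℓ.prod fun i k => (i - 1)! ^ k := by
    rw [ψ.prod_comp fun x => ((x.1 : ℕ) - 1)!, Fintype.prod_sigma, Finsupp.prod,
      ← prod_coe_sort ℓ.support fun i => (i - 1)! ^ ℓ i]
    simp
  have key := numConnects_mul (V := Fin n) (π := id) Function.surjective_id
    (s := fun j => ((ψ j).1 : ℕ)) (fun j => (hℓ _ (ψ j).1.2).trans' one_le_two)
    (by rw [hsum, Fintype.card_fin]; omega)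
  have hfib : ∏ q, fibreCard (id : Fin n → Fin n) q = 1 :=
    prod_eq_one fun q _ => by simp [fibreCard, filter_eq']
  rw [hfib, one_mul, hprod, ← numConnected_eq_numConnects n (by omega) hℓ ψ, Fintype.card_fin,
    card_edgeIndex] at key
  exact key

/-! ### Partitions as edge numbers. -/

/-- The edge numbers encoded by a partition, a part `i` giving an edge of size `i + 1`. -/
noncomputable def edgeNumbers (m : Multiset ℕ) : ℕ →₀ ℕ := (Multiset.toFinsupp m).mapDomain Nat.succ

theorem edgeNumbers_injective : Function.Injective edgeNumbers :=
  (Finsupp.mapDomain_injective Nat.succ_injective).comp Multiset.toFinsupp.injective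

theorem edgeNumbers_eq_sum (m : Multiset ℕ) :
    edgeNumbers m = ∑ i ∈ m.toFinset, Finsupp.single (i + 1) (m.count i) := by
  rw [edgeNumbers, Finsupp.mapDomain, Finsupp.sum, Multiset.toFinsupp_support]
  rfl

theorem edgeNumbers_prod {M : Type} [CommMonoid M] (m : Multiset ℕ) (h : ℕ → ℕ → M) :
    (edgeNumbers m).prod h = ∏ i ∈ m.toFinset, h (i + 1) (m.count i) := by
  rw [edgeNumbers, Finsupp.prod_mapDomain_index_inj Nat.succ_injective, Finsupp.prod,
    Multiset.toFinsupp_support]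
  rfl

theorem edgeNumbers_sum {M : Type} [AddCommMonoid M] (m : Multiset ℕ) (h : ℕ → ℕ → M) :
    (edgeNumbers m).sum h = ∑ i ∈ m.toFinset, h (i + 1) (m.count i) := by
  rw [edgeNumbers, Finsupp.sum_mapDomain_index_inj Nat.succ_injective, Finsupp.sum,
    Multiset.toFinsupp_support]
  rfl

theorem magnitude_edgeNumbers (m : Multiset ℕ) : magnitude (edgeNumbers m) = m.sum := by
  rw [magnitude, edgeNumbers_sum, sum_multiset_count]
  simp [mul_comm]

theorem two_le_of_mem_support_edgeNumbers {m : Multiset ℕ} (hm : ∀ i ∈ m, 0 < i) {i : ℕ}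
    (hi : i ∈ (edgeNumbers m).support) : 2 ≤ i := by
  classical
  obtain ⟨j, hj, rfl⟩ := mem_image.1 (Finsupp.mapDomain_support hi)
  rw [Multiset.toFinsupp_support, Multiset.mem_toFinset] at hj
  have := hm j hj
  omega

theorem exists_partition_edgeNumbers {ℓ : ℕ →₀ ℕ} (hℓ : ∀ i ∈ ℓ.support, 2 ≤ i) :
    ∃ p : Nat.Partition (magnitude ℓ), edgeNumbers p.parts = ℓ := by
  classical
  -- Undoes the shift by one; since the support starts at 2, nothing is lost and all parts are
  -- positive.
  let m : Multiset ℕ := Finsupp.toMultiset (ℓ.comapDomain Nat.succ Nat.succ_injective.injOn)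
  have hm : edgeNumbers m = ℓ := by
    rw [edgeNumbers, Finsupp.toMultiset_toFinsupp]
    refine Finsupp.mapDomain_comapDomain _ Nat.succ_injective _ fun i hi => ?_
    exact ⟨i - 1, by have := hℓ i hi; simp only [Nat.succ_eq_add_one]; omega⟩
  refine ⟨⟨m, fun {i} hi => ?_, by rw [← magnitude_edgeNumbers, hm]⟩, hm⟩
  rw [Finsupp.mem_toMultiset] at hi
  have := hℓ (i + 1) (by simpa using hi)
  omega

/-- The coefficient of `u ^ ℓ` in `[t ^ n / n!] R`, where `ℓ` encodes the partition `m`. -/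
def weight (n : ℕ) (m : Multiset ℕ) : ℚ :=
  ((n - 1)! : ℚ) / (m.map fun k => (k ! : ℚ)).prod *
    ∏ i ∈ m.toFinset, (n : ℚ) ^ m.count i / ((m.count i)! : ℚ)

theorem partition_term_eq_monomial (n : ℕ) (p : Nat.Partition (n - 1)) :
    (multinomialOfParts p •
      ∏ i ∈ Finset.Icc 1 (n - 1), (1 / ((p.parts.count i)! : ℚ)) •
        ((n : Coeffs) * u (i + 1)) ^ (p.parts.count i)) =
      MvPowerSeries.monomial (edgeNumbers p.parts) (weight n p.parts) := by
  have hsub : p.parts.toFinset ⊆ Finset.Icc 1 (n - 1) := fun i hi => by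
    rw [Multiset.mem_toFinset] at hi
    exact mem_Icc.2 ⟨p.parts_pos hi, p.le_of_mem_parts hi⟩
  -- Sizes that do not occur have exponent 0 and contribute the factor 1.
  rw [← prod_subset hsub fun i _ hi => by
    rw [Multiset.mem_toFinset, ← Multiset.count_eq_zero] at hi
    simp [hi]]
  have hfac : ∀ i, (1 / ((p.parts.count i)! : ℚ)) •
      ((n : Coeffs) * u (i + 1)) ^ (p.parts.count i) =
      MvPowerSeries.monomial (Finsupp.single (i + 1) (p.parts.count i))
        ((n : ℚ) ^ p.parts.count i / ((p.parts.count i)! : ℚ)) := by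
    intro i
    rw [mul_pow, u, MvPowerSeries.X_pow_eq, ← Nat.cast_pow, ← nsmul_eq_mul, ← map_nsmul,
      ← map_smul]
    congr 1
    simp
    ring
  rw [prod_congr rfl fun i _ => hfac i, MvPowerSeries.prod_monomial, ← edgeNumbers_eq_sum,
    ← map_smul]
  rfl

/-! ### Coefficients of the generating functions. -/

theorem factorial_smul_inv_smul (n : ℕ) (x : Coeffs) :
    (n ! : ℚ) • (1 / (n ! : ℚ)) • x = x := by
  rw [smul_smul, mul_one_div_cancel (Nat.cast_ne_zero.2 n.factorial_ne_zero), one_smul]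

theorem egfCoeff_T (n : ℕ) : egfCoeff n T = leadingPart n := by
  rw [egfCoeff, T, PowerSeries.coeff_mk, factorial_smul_inv_smul]

theorem egfCoeff_R (n : ℕ) : egfCoeff n R = (n : ℚ) • egfCoeff n T := by
  cases n with
  | zero => simp [egfCoeff, R]
  | succ n =>
    rw [egfCoeff, egfCoeff, R, PowerSeries.coeff_succ_X_mul, PowerSeries.coeff_derivative,
      smul_comm]
    congr 1
    rw [Algebra.smul_def, mul_comm]
    simp

theorem coeff_leadingPart (n : ℕ) (ℓ : ℕ →₀ ℕ) :
    MvPowerSeries.coeff ℓ (leadingPart n) =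
      if magnitude ℓ + 1 = n then
        (numConnected n ℓ : ℚ) / ℓ.prod fun _ k => (k ! : ℚ) else 0 := by
  change (if magnitude ℓ + 1 = n then MvPowerSeries.coeff ℓ (egfCoeff n C) else 0) = _
  have hC : egfCoeff n C =
      ((fun ℓ : ℕ →₀ ℕ => (numConnected n ℓ : ℚ) / ℓ.prod fun _ k => (k ! : ℚ)) : Coeffs) :=
    (congrArg _ (PowerSeries.coeff_mk _ _)).trans (factorial_smul_inv_smul n _)
  rw [hC]
  rfl

theorem mul_numConnected_div {n : ℕ} (hn : 1 ≤ n) (p : Nat.Partition (n - 1)) :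
    (n : ℚ) * ((numConnected n (edgeNumbers p.parts) : ℚ) /
      (edgeNumbers p.parts).prod fun _ k => (k ! : ℚ)) = weight n p.parts := by
  have key := numConnected_mul (n := n) (ℓ := edgeNumbers p.parts)
    (fun i => two_le_of_mem_support_edgeNumbers fun _ => p.parts_pos)
    (by rw [magnitude_edgeNumbers, p.parts_sum]; omega)
  rw [edgeNumbers_prod, edgeNumbers_sum] at key
  simp only [Nat.add_sub_cancel] at key
  have key : (numConnected n (edgeNumbers p.parts) : ℚ) *
      (∏ i ∈ p.parts.toFinset, (i ! : ℚ) ^ p.parts.count i) * n =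
      (n : ℚ) ^ (∑ i ∈ p.parts.toFinset, p.parts.count i) * ((n - 1)! : ℚ) := by
    exact_mod_cast key
  have h1 : (∏ i ∈ p.parts.toFinset, (i ! : ℚ) ^ p.parts.count i) ≠ 0 :=
    prod_ne_zero_iff.2 fun i _ => pow_ne_zero _ (Nat.cast_ne_zero.2 i.factorial_ne_zero)
  have h2 : (∏ i ∈ p.parts.toFinset, ((p.parts.count i)! : ℚ)) ≠ 0 :=
    prod_ne_zero_iff.2 fun i _ => Nat.cast_ne_zero.2 (Nat.factorial_ne_zero _)
  rw [weight, edgeNumbers_prod, prod_multiset_map_count, prod_div_distrib, prod_pow_eq_pow_sum]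
  field_simp
  linarith

/-- Coefficients are compared at each `ℓ`: as `edgeNumbers` is injective, at most one partition
contributes. -/
theorem egfCoeff_R_eq_sum_monomial {n : ℕ} (hn : 1 ≤ n) :
    egfCoeff n R = ∑ p : Nat.Partition (n - 1),
      MvPowerSeries.monomial (edgeNumbers p.parts) (weight n p.parts) := by
  classical
  ext ℓ
  rw [egfCoeff_R, egfCoeff_T, MvPowerSeries.coeff_smul, coeff_leadingPart, map_sum]
  simp only [MvPowerSeries.coeff_monomial]
  by_cases h : ∃ p : Nat.Partition (n - 1), edgeNumbers p.parts = ℓ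
  · obtain ⟨p, rfl⟩ := h
    have hp : ∀ q : Nat.Partition (n - 1),
        edgeNumbers p.parts = edgeNumbers q.parts ↔ q = p := fun q =>
      ⟨fun h => Nat.Partition.ext (edgeNumbers_injective h.symm), fun h => by rw [h]⟩
    simp only [hp, sum_ite_eq', mem_univ, if_true]
    rw [if_pos (by rw [magnitude_edgeNumbers, p.parts_sum]; omega), mul_numConnected_div hn]
  · rw [sum_eq_zero fun p _ => if_neg fun hp => h ⟨p, hp.symm⟩]
    split_ifs with hm
    · by_cases hℓ : ∀ i ∈ ℓ.support, 2 ≤ i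
      · have hp := exists_partition_edgeNumbers hℓ
        rw [show magnitude ℓ = n - 1 by omega] at hp
        exact absurd hp h
      · push Not at hℓ
        obtain ⟨i, hi, hi2⟩ := hℓ
        simp [numConnected_eq_zero n hi hi2]
    · simp

theorem egfCoeff_T_eq_smul {n : ℕ} (hn : 1 ≤ n) :
    egfCoeff n T = (1 / (n : ℚ)) • egfCoeff n R := by
  rw [egfCoeff_R, smul_smul, one_div_mul_cancel (Nat.cast_ne_zero.2 (by omega)), one_smul]

/-! ### Explicit coefficients for small `n`. -/

theorem ofNat_rat_smul (k : ℕ) [k.AtLeastTwo] (x : Coeffs) :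
    (ofNat(k) : ℚ) • x = ofNat(k) * x := by
  rw [MvPowerSeries.smul_eq_C_mul, map_ofNat]

/-- The partitions of `n` with all parts at most `k`. -/
def partitionsUpTo : ℕ → ℕ → List (Multiset ℕ)
  | 0, n => if n = 0 then [0] else []
  | k + 1, n => (List.range (n / (k + 1) + 1)).flatMap fun c =>
      (partitionsUpTo k (n - c * (k + 1))).map (Multiset.replicate c (k + 1) + ·)

/-- The copies of the largest allowed part are split off, and induction applies to the rest. -/
theorem mem_partitionsUpTo {k : ℕ} {m : Multiset ℕ} (h0 : ∀ i ∈ m, 0 < i) (hk : ∀ i ∈ m, i ≤ k) :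
    m ∈ partitionsUpTo k m.sum := by
  induction k generalizing m with
  | zero =>
    have : m = 0 := Multiset.eq_zero_of_forall_notMem fun i hi => by
      have := h0 i hi
      have := hk i hi
      omega
    simp [this, partitionsUpTo]
  | succ k ih =>
    have hm := Multiset.filter_add_not (k + 1 = ·) m
    rw [Multiset.filter_eq] at hm
    have hs := congrArg Multiset.sum hm
    rw [Multiset.sum_add, Multiset.sum_replicate, smul_eq_mul] at hs
    simp only [partitionsUpTo, List.mem_flatMap, List.mem_range, List.mem_map]
    refine ⟨m.count (k + 1), Nat.lt_succ_of_le ((Nat.le_div_iff_mul_le (by omega)).2 (by omega)),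
      m.filter (¬ k + 1 = ·), ?_, hm⟩
    rw [← hs, Nat.add_sub_cancel_left]
    refine ih (fun i hi => h0 i (Multiset.mem_filter.1 hi).1) fun i hi => ?_
    obtain ⟨h1, h2⟩ := Multiset.mem_filter.1 hi
    have := hk i h1
    omega

/-- The recursion `partitionsUpTo` guarantees that `L` is complete; `hmem` and `hnodup` ensure that
`L` has nothing superfluous. For a concrete `L` all three are decidable. -/
theorem sum_partition_eq {M : Type} [AddCommMonoid M] {n : ℕ} {L : List (Multiset ℕ)}
    (hL : partitionsUpTo n n = L) (hnodup : L.Nodup)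
    (hmem : ∀ m ∈ L, (∀ i ∈ m, 0 < i) ∧ m.sum = n) (F : Multiset ℕ → M) :
    ∑ p : Nat.Partition n, F p.parts = (L.map F).sum := by
  rw [← List.sum_toFinset F hnodup]
  refine sum_bij (fun p _ => p.parts) (fun p _ => ?_)
    (fun p _ q _ h => Nat.Partition.ext h) (fun m hm => ?_) (fun _ _ => rfl)
  · rw [List.mem_toFinset, ← hL]
    have := mem_partitionsUpTo (k := n) (fun _ => p.parts_pos) fun _ => p.le_of_mem_parts
    rwa [p.parts_sum] at this
  · have h := hmem m (List.mem_toFinset.1 hm)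
    exact ⟨⟨m, fun {i} => h.1 i, h.2⟩, mem_univ _, rfl⟩

theorem egfCoeff_T_eq_list_sum {n : ℕ} {L : List (Multiset ℕ)}
    (hL : partitionsUpTo n n = L) (hnodup : L.Nodup)
    (hmem : ∀ m ∈ L, (∀ i ∈ m, 0 < i) ∧ m.sum = n) :
    egfCoeff (n + 1) T = (L.map fun m => (weight (n + 1) m / (n + 1 : ℕ)) •
      (m.map fun i => u (i + 1)).prod).sum := by
  rw [← sum_partition_eq hL hnodup hmem, egfCoeff_T_eq_smul (by omega),
    egfCoeff_R_eq_sum_monomial (by omega), smul_sum]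
  refine sum_congr rfl fun p _ => ?_
  rw [prod_multiset_map_count]
  simp only [u, MvPowerSeries.X_pow_eq]
  rw [MvPowerSeries.prod_monomial, ← edgeNumbers_eq_sum, ← map_smul, ← map_smul]
  congr 1
  simp
  ring

end Hyper

theorem mainTheorem7 :
    (∀ n : ℕ, 1 ≤ n →
      Hyper.egfCoeff n Hyper.R =
        ∑ p : Nat.Partition (n - 1), Hyper.multinomialOfParts p •
          ∏ i ∈ Finset.Icc 1 (n - 1),
            (1 / ((p.parts.count i)! : ℚ)) •
              ((n : Hyper.Coeffs) * Hyper.u (i + 1)) ^ (p.parts.count i)) ∧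
    (∀ n : ℕ, 1 ≤ n →
      Hyper.egfCoeff n Hyper.T = (1 / (n : ℚ)) • Hyper.egfCoeff n Hyper.R) ∧
    Hyper.egfCoeff 1 Hyper.T = 1 ∧
    Hyper.egfCoeff 2 Hyper.T = Hyper.u 2 ∧
    Hyper.egfCoeff 3 Hyper.T = Hyper.u 3 + 3 * Hyper.u 2 ^ 2 ∧
    Hyper.egfCoeff 4 Hyper.T =
      Hyper.u 4 + 12 * Hyper.u 2 * Hyper.u 3 + 16 * Hyper.u 2 ^ 3 ∧
    Hyper.egfCoeff 5 Hyper.T =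
      Hyper.u 5 + 20 * Hyper.u 2 * Hyper.u 4 + 15 * Hyper.u 3 ^ 2
        + 150 * Hyper.u 3 * Hyper.u 2 ^ 2 + 125 * Hyper.u 2 ^ 4 ∧
    Hyper.egfCoeff 6 Hyper.T =
      Hyper.u 6 + 30 * Hyper.u 2 * Hyper.u 5 + 60 * Hyper.u 4 * Hyper.u 3
        + 360 * Hyper.u 4 * Hyper.u 2 ^ 2 + 540 * Hyper.u 2 * Hyper.u 3 ^ 2
        + 2160 * Hyper.u 3 * Hyper.u 2 ^ 3 + 1296 * Hyper.u 2 ^ 5 := by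
  refine ⟨fun n hn => ?_, fun n => Hyper.egfCoeff_T_eq_smul, ?_, ?_, ?_, ?_, ?_, ?_⟩
  · rw [Hyper.egfCoeff_R_eq_sum_monomial hn]
    exact Finset.sum_congr rfl fun p _ => (Hyper.partition_term_eq_monomial n p).symm
  · rw [Hyper.egfCoeff_T_eq_list_sum (n := 0) (L := [0]) (by decide) (by decide) (by decide)]
    simp [Hyper.weight]
  · rw [Hyper.egfCoeff_T_eq_list_sum (n := 1) (L := [{1}]) (by decide) (by decide) (by decide)]
    simp [Hyper.weight]
  · rw [Hyper.egfCoeff_T_eq_list_sum (n := 2) (L := [{1, 1}, {2}])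
      (by decide) (by decide) (by decide)]
    simp [Hyper.weight]
    norm_num [Nat.factorial, Hyper.ofNat_rat_smul]
    ring
  · rw [Hyper.egfCoeff_T_eq_list_sum (n := 3) (L := [{1, 1, 1}, {1, 2}, {3}])
      (by decide) (by decide) (by decide)]
    simp [Hyper.weight]
    norm_num [Nat.factorial, Hyper.ofNat_rat_smul]
    ring
  · rw [Hyper.egfCoeff_T_eq_list_sum (n := 4)
      (L := [{1, 1, 1, 1}, {1, 1, 2}, {2, 2}, {1, 3}, {4}])
      (by decide) (by decide) (by decide)]
    simp [Hyper.weight]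
    norm_num [Nat.factorial, Hyper.ofNat_rat_smul]
    ring
  · rw [Hyper.egfCoeff_T_eq_list_sum (n := 5)
      (L := [{1, 1, 1, 1, 1}, {1, 1, 1, 2}, {1, 2, 2}, {1, 1, 3}, {2, 3}, {1, 4}, {5}])
      (by decide) (by decide) (by decide)]
    simp [Hyper.weight]
    norm_num [Nat.factorial, Hyper.ofNat_rat_smul]
    ring
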